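/- For a finite graph $G$, let $h(G)$ be its Hadwiger number, i.e. the order of the largest clique which is a minor of $G$. A bramble for $G$ is a collection $\mathcal B$ of connected subgraphs of $G$ such that any two $B,B'\in\mathcal B$ share a vertex or are joined by an edge of $G$. The fractional Hadwiger number $h_f(G)$ is the maximum of $\sum_{B\in\mathcal B}w(B)$ over all brambles $\mathcal B$ for $G$ and all weight functions $w:\mathcal B\to\mathbb R_{\ge 0}$ such that, for each vertex $v$, the sum of the weights of the subgraphs in $\mathcal B$ containing $v$ is at most $1$. Let $G(n,p)$ be the random graph on $n$ vertices in which each pair of vertices is an edge independently with probability $p$. Theorem. Fix $0<p<1$ and let $b=1/(1-p)$. Then, with probability tending to $1$ as $n\to\infty$, $$h_f(G(n,p))=(1+o(1))\frac{n}{\sqrt{\log_b n}},$$ and the fractional Hadwiger number of the random graph is asymptotically equal to its Hadwiger number: $h_f(G(n,p))=(1+o(1))\,h(G(n,p))$. That is, for every $\varepsilon>0$, $$\Pr\left[\left|h_f(G(n,p))-\frac{n}{\sqrt{\log_b n}}\right|\le\varepsilon\frac{n}{\sqrt{\log_b n}}\right]\to 1\quad\text{and}\quad\Pr\Big[\left|h_f(G(n,p))-h(G(n,p))\right|\le\varepsilon\,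 h(G(n,p))\Big]\to 1\qquad(n\to\infty).$$ -/

import Mathlib

/-- `H` is a minor of `G`: there are pairwise disjoint vertex sets `S i` of `G`, one for each vertex
`i` of `H`, each inducing a connected (so nonempty) subgraph of `G`, such that for each edge `i j`
of `H` there is an edge of `G` between `S i` and `S j`. -/
def SimpleGraph.IsMinorOf {W V : Type*} (H : SimpleGraph W) (G : SimpleGraph V) : Prop :=
  ∃ S : W → Set V,
    (∀ i, (G.induce (S i)).Connected) ∧
    (∀ i j, i ≠ j → Disjoint (S i) (S j)) ∧
    (∀ i j, H.Adj i j → ∃ u ∈ S i, ∃ v ∈ S j, G.Adj u v)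

/-- The Hadwiger number: the order of the largest clique which is a minor of `G`. -/
noncomputable def SimpleGraph.hadwigerNumber {V : Type*} (G : SimpleGraph V) : ℕ :=
  sSup {t : ℕ | (⊤ : SimpleGraph (Fin t)).IsMinorOf G}

/-- A bramble for `G`: a collection of connected subgraphs of `G` such that any two of them
share a vertex or are joined by an edge of `G`. -/
def SimpleGraph.IsBramble {V : Type*} (G : SimpleGraph V) (ℬ : Finset G.Subgraph) : Prop :=
  (∀ B ∈ ℬ, B.Connected) ∧
    ∀ B ∈ ℬ, ∀ B' ∈ ℬ,
      (∃ v, v ∈ B.verts ∧ v ∈ B'.verts) ∨ ∃ u ∈ B.verts, ∃ v ∈ B'.verts, G.Adj u v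

open Classical in
/-- The total weights `∑ B ∈ ℬ, w B` of nonnegative weightings `w` of brambles `ℬ` for `G`
for which the members of `ℬ` containing any given vertex have total weight at most `1`. -/
def SimpleGraph.brambleWeights {V : Type*} (G : SimpleGraph V) : Set ℝ :=
  {h | ∃ ℬ : Finset G.Subgraph, G.IsBramble ℬ ∧
    ∃ w : G.Subgraph → ℝ, (∀ B ∈ ℬ, 0 ≤ w B) ∧
      (∀ v : V, ∑ B ∈ ℬ with v ∈ B.verts, w B ≤ 1) ∧
      h = ∑ B ∈ ℬ, w B}

/-- The fractional Hadwiger number `h_f(G)` (for finite `G`, the supremum is a maximum: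
see `SimpleGraph.isGreatest_fractionalHadwigerNumber`). -/
noncomputable def SimpleGraph.fractionalHadwigerNumber {V : Type*} (G : SimpleGraph V) : ℝ :=
  sSup G.brambleWeights

/-- On a finite vertex set the Hadwiger number is a maximum. -/
theorem SimpleGraph.isGreatest_hadwigerNumber {V : Type*} [Finite V] (G : SimpleGraph V) :
    IsGreatest {t : ℕ | (⊤ : SimpleGraph (Fin t)).IsMinorOf G} G.hadwigerNumber := by
  have hne : {t : ℕ | (⊤ : SimpleGraph (Fin t)).IsMinorOf G}.Nonempty :=
    ⟨0, fun i => i.elim0, fun i => i.elim0, fun i => i.elim0, fun i => i.elim0⟩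
  have hb : BddAbove {t : ℕ | (⊤ : SimpleGraph (Fin t)).IsMinorOf G} := by
    refine ⟨Nat.card V, ?_⟩
    rintro t ⟨S, hc, hd, -⟩
    have hn : ∀ i, ∃ v, v ∈ S i := fun i => by
      obtain ⟨x⟩ := (hc i).nonempty
      exact ⟨x.1, x.2⟩
    choose f hf using hn
    have hinj : Function.Injective f := by
      intro i j hij
      by_contra hne
      exact Set.disjoint_left.1 (hd i j hne) (hf i) (hij ▸ hf j)
    simpa using Nat.card_le_card_of_injective f hinj
  exact ⟨Nat.sSup_mem hne hb, fun t ht => le_csSup hb ht⟩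

/-- On a finite vertex set the fractional Hadwiger number is a maximum. -/
theorem SimpleGraph.isGreatest_fractionalHadwigerNumber {V : Type*} [Finite V]
    (G : SimpleGraph V) : IsGreatest G.brambleWeights G.fractionalHadwigerNumber := by
  classical
  have : Fintype V := Fintype.ofFinite V
  have : Fintype G.Subgraph := Fintype.ofFinite _
  let K : Finset G.Subgraph → Set (G.Subgraph → ℝ) := fun ℬ =>
    {w | (∀ B, w B ∈ Set.Icc (0 : ℝ) 1) ∧ ∀ v : V, ∑ B ∈ ℬ with v ∈ B.verts, w B ≤ 1}
  have hK : ∀ ℬ, IsCompact (K ℬ) := by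
    intro ℬ
    have h1 : IsCompact (Set.univ.pi fun _ : G.Subgraph => Set.Icc (0 : ℝ) 1) :=
      isCompact_univ_pi fun _ => isCompact_Icc
    have h2 : IsClosed {w : G.Subgraph → ℝ |
        ∀ v : V, ∑ B ∈ ℬ with v ∈ B.verts, w B ≤ 1} := by
      rw [Set.ofPred_forall]
      exact isClosed_iInter fun v => isClosed_le (by fun_prop) continuous_const
    convert h1.inter_right h2 using 1
    ext w
    simp only [K, Set.mem_inter_iff, Set.mem_ofPred_eq, Set.mem_pi, Set.mem_univ, true_imp_iff]
  have hcover : G.brambleWeights =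
      ⋃ ℬ ∈ {ℬ : Finset G.Subgraph | G.IsBramble ℬ},
        (fun w : G.Subgraph → ℝ => ∑ B ∈ ℬ, w B) '' K ℬ := by
    ext h
    simp only [Set.mem_iUnion, Set.mem_image, exists_prop]
    constructor
    · rintro ⟨ℬ, hB, w, hw0, hw1, rfl⟩
      refine ⟨ℬ, hB, fun B => if B ∈ ℬ then w B else 0, ⟨fun B => ?_, fun v => ?_⟩, ?_⟩
      · by_cases hb : B ∈ ℬ
        · obtain ⟨v, hv⟩ := (hB.1 B hb).nonempty
          have hle : w B ≤ ∑ B ∈ ℬ with v ∈ B.verts, w B :=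
            Finset.single_le_sum (f := w)
              (fun C hC => hw0 C (Finset.mem_filter.1 hC).1)
              (Finset.mem_filter.2 ⟨hb, hv⟩)
          simpa [hb] using And.intro (hw0 B hb) (hle.trans (hw1 v))
        · simp [hb]
      · refine le_trans (le_of_eq ?_) (hw1 v)
        exact Finset.sum_congr rfl fun B hb => if_pos (Finset.mem_filter.1 hb).1
      · exact Finset.sum_congr rfl fun B hb => if_pos hb
    · rintro ⟨ℬ, hB, w, hw, rfl⟩
      exact ⟨ℬ, hB, w, fun B _ => (hw.1 B).1, hw.2, rfl⟩
  have hcomp : IsCompact G.brambleWeights := by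
    rw [hcover]
    exact (Set.toFinite _).isCompact_biUnion fun ℬ _ => (hK ℬ).image (by fun_prop)
  have hne : G.brambleWeights.Nonempty :=
    ⟨0, ∅, ⟨by simp, by simp⟩, 0, by simp, by simp, by simp⟩
  exact hcomp.isGreatest_sSup hne

/-! Write `r = √(log_b n)`. Since `h ≤ h_f` for every graph
(`hadwigerNumber_le_fractionalHadwigerNumber`), both claims follow once `h ≥ (1 - ε) n / r` and `h_f
≤ (1 + ε) n / r` hold with high probability.

Upper bound. In a weighted bramble, the members with more than `m` vertices have total weight at
most `n / (m + 1)`. The members with at most `m` vertices all meet a maximal disjoint family `F` of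
such members, so they weigh at most `m |F|` (`IsBramble.exists_pairwiseDisjoint_le`). A large `h_f`
thus yields `2k` disjoint, pairwise adjacent sets of size at most `m`. A union bound gives this
probability at most `n ^ (2km) (1 - (1 - p) ^ (m²)) ^ (k²)`
(`binomialRandom_real_exists_disjoint_adj_le`). For `m` slightly below `r` and `k` a small multiple
of `n / r²`, each cross pair fails with probability at least `n ^ (-α)`, `α < 1`, so the second
factor wins (`one_sub_pow_mul_le_inv`).

Lower bound. Take about `n / s` disjoint sets of size `s` slightly above `r`. The expected number of
disconnected sets and non-adjacent pairs is of smaller order than the number of sets. By Markov's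
inequality, deleting one set per defect costs little (`mul_binomialRandom_real_hadwigerNumber_le`).
-/

/-! ### Independence of the edges of `G(n,p)`. -/

open MeasureTheory ProbabilityTheory unitInterval in
theorem SimpleGraph.iIndepFun_mem_edgeSet {V : Type*} [Countable V] (p : unitInterval) :
    iIndepFun (fun (e : Sym2 V) (G : SimpleGraph V) => e ∈ G.edgeSet)
      (SimpleGraph.binomialRandom V p) := by
  -- `fromEdgeSet` discards loops, so whether `e` is an edge is a function of the coordinate at `e`
  -- alone: that coordinate, cut off on the diagonal.
  have h := iIndepFun_infinitePi
    (P := fun e : Sym2 V => toNNReal p • Measure.dirac (e ∈ (Sym2.diagSetᶜ : Set (Sym2 V))) +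
      toNNReal (σ p) • Measure.dirac False)
    (X := fun e P => P ∧ e ∉ (Sym2.diagSet : Set (Sym2 V))) (fun e => Measurable.of_discrete)
  have hm : Measurable fun p : Sym2 V → Prop => {e | p e} := measurable_set_iff.2 fun e => by
    simpa using measurable_pi_apply e
  rw [binomialRandom_eq_map, setBernoulli_eq_map, Measure.map_map (by fun_prop) hm]
  rw [iIndepFun_iff_measure_inter_preimage_eq_mul] at h ⊢
  have hX : ∀ e : Sym2 V, Measurable fun G : SimpleGraph V => e ∈ G.edgeSet := fun e => by
    exact measurable_set_iff.1 measurable_edgeSet e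
  intro S sets hS
  have hc : Measurable (fromEdgeSet ∘ fun p : Sym2 V → Prop => {e | p e}) :=
    measurable_fromEdgeSet.comp hm
  rw [Measure.map_apply hc (Finset.measurableSet_biInter _ fun e he => hX e (hS e he)),
    Set.preimage_iInter₂]
  convert h S hS using 1
  · congr 1
    ext ω
    simp
  · refine Finset.prod_congr rfl fun e he => ?_
    rw [Measure.map_apply hc (hX e (hS e he))]
    congr 1
    ext ω
    simp

open MeasureTheory ProbabilityTheory unitInterval in
theorem SimpleGraph.binomialRandom_real_mem_edgeSet {V : Type*} [Countable V] (p : unitInterval)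
    {e : Sym2 V} (he : ¬ e.IsDiag) :
    (SimpleGraph.binomialRandom V p).real {G | e ∈ G.edgeSet} = p := by
  have hm : Measurable fun p : Sym2 V → Prop => {e | p e} := measurable_set_iff.2 fun e => by
    simpa using measurable_pi_apply e
  have hX : MeasurableSet {G : SimpleGraph V | e ∈ G.edgeSet} :=
    measurableSet_setOfPred.2 (measurable_set_iff.1 measurable_edgeSet e)
  rw [binomialRandom_eq_map, setBernoulli_eq_map, Measure.map_map (by fun_prop) hm,
    measureReal_def, Measure.map_apply (measurable_fromEdgeSet.comp hm) hX]
  have h : (fromEdgeSet ∘ fun p : Sym2 V → Prop => {e | p e}) ⁻¹' {G | e ∈ G.edgeSet} =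
      (fun ω : Sym2 V → Prop => ω e) ⁻¹' {True} := by
    ext ω
    simp [he]
  rw [h, ← Measure.map_apply (measurable_pi_apply e) (by measurability),
    Measure.infinitePi_map_eval]
  simp [he]

/-- Makes every event about a finite random graph measurable. -/
instance SimpleGraph.instDiscreteMeasurableSpace {V : Type*} [Finite V] :
    DiscreteMeasurableSpace (SimpleGraph V) := by
  have : MeasurableSingletonClass (SimpleGraph V) := ⟨fun G => by
    have h : ({G} : Set (SimpleGraph V)) = edgeSet ⁻¹' {G.edgeSet} := by
      ext H
      simp
    rw [h]
    exact measurable_edgeSet (MeasurableSet.singleton _)⟩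
  infer_instance

/-- Membership of a graph in the family `E` is decided by which pairs in `F` are edges. -/
def SimpleGraph.DeterminedBy {V : Type*} (E : Set (SimpleGraph V)) (F : Finset (Sym2 V)) : Prop :=
  ∀ G H : SimpleGraph V, (∀ e ∈ F, e ∈ G.edgeSet ↔ e ∈ H.edgeSet) → G ∈ E → H ∈ E

theorem SimpleGraph.DeterminedBy.measureReal_inter {V : Type*} [Finite V] (p : unitInterval)
    {E E' : Set (SimpleGraph V)} {F F' : Finset (Sym2 V)} (hE : DeterminedBy E F)
    (hE' : DeterminedBy E' F') (hF : Disjoint F F') :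
    (binomialRandom V p).real (E ∩ E') =
      (binomialRandom V p).real E * (binomialRandom V p).real E' := by
  -- An event determined by `F` is the preimage of its image under restriction to `F`, so
  -- independence of the two restrictions applies to it.
  have key : ∀ {E : Set (SimpleGraph V)} {F : Finset (Sym2 V)}, DeterminedBy E F →
      (fun (G : SimpleGraph V) (e : F) => (e : Sym2 V) ∈ G.edgeSet) ⁻¹'
        ((fun (G : SimpleGraph V) (e : F) => (e : Sym2 V) ∈ G.edgeSet) '' E) = E := by
    intro E F h
    refine subset_antisymm ?_ (Set.subset_preimage_image _ _)
    rintro H ⟨G, hG, hGH⟩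
    exact h G H (fun e he => iff_of_eq (congrFun hGH ⟨e, he⟩)) hG
  have h := (iIndepFun_mem_edgeSet p).indepFun_finset (μ := binomialRandom V p) F F' hF
    fun e => Measurable.of_discrete
  have h2 := h.measure_inter_preimage_eq_mul _ _
    ((Set.toFinite ((fun (G : SimpleGraph V) (e : F) => (e : Sym2 V) ∈ G.edgeSet) '' E)
      ).measurableSet)
    ((Set.toFinite ((fun (G : SimpleGraph V) (e : F') => (e : Sym2 V) ∈ G.edgeSet) '' E')
      ).measurableSet)
  rw [key hE, key hE'] at h2
  simp [MeasureTheory.measureReal_def, h2]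

theorem SimpleGraph.measureReal_biInter_eq_prod {V J : Type*} [Finite V] (p : unitInterval)
    {E : J → Set (SimpleGraph V)} {F : J → Finset (Sym2 V)} (T : Finset J)
    (hE : ∀ j ∈ T, DeterminedBy (E j) (F j)) (hF : (T : Set J).PairwiseDisjoint F) :
    (binomialRandom V p).real (⋂ j ∈ T, E j) = ∏ j ∈ T, (binomialRandom V p).real (E j) := by
  classical
  induction T using Finset.induction_on with
  | empty => simp
  | insert a T ha ih =>
    rw [Finset.prod_insert ha, Finset.set_biInter_insert,
      ← ih (fun j hj => hE j (Finset.mem_insert_of_mem hj))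
        (hF.subset (by simp))]
    refine DeterminedBy.measureReal_inter p (F' := T.biUnion F)
      (hE a (Finset.mem_insert_self _ _)) ?_ ?_
    · intro G H h hG
      simp only [Set.mem_iInter] at hG ⊢
      exact fun j hj => hE j (Finset.mem_insert_of_mem hj) G H
        (fun e he => h e (Finset.mem_biUnion.2 ⟨j, hj, he⟩)) (hG j hj)
    · rw [Finset.disjoint_biUnion_right]
      exact fun j hj => hF (by simp) (by simp [hj]) (by rintro rfl; exact ha hj)

theorem SimpleGraph.binomialRandom_real_notMem_edgeSet {V : Type*} [Finite V] (p : unitInterval)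
    {e : Sym2 V} (he : ¬ e.IsDiag) :
    (binomialRandom V p).real {G | e ∉ G.edgeSet} = 1 - p := by
  rw [← binomialRandom_real_mem_edgeSet p he, ← MeasureTheory.probReal_compl_eq_one_sub .of_discrete]
  rfl

theorem SimpleGraph.binomialRandom_real_forall_notMem {V : Type*} [Finite V] (p : unitInterval)
    {F : Finset (Sym2 V)} (hF : ∀ e ∈ F, ¬ e.IsDiag) :
    (binomialRandom V p).real {G | ∀ e ∈ F, e ∉ G.edgeSet} = (1 - p) ^ F.card := by
  have h := measureReal_biInter_eq_prod p (V := V) (E := fun e => {G | e ∉ G.edgeSet})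
    (F := fun e => {e}) F (fun e _ G H h hG => by simpa [← h e] using hG)
    (fun e _ e' _ h => by simpa using h)
  have h1 : {G : SimpleGraph V | ∀ e ∈ F, e ∉ G.edgeSet} = ⋂ e ∈ F, {G | e ∉ G.edgeSet} := by
    ext; simp
  rw [h1, h, Finset.prod_congr rfl fun e he => binomialRandom_real_notMem_edgeSet p (hF e he),
    Finset.prod_const]

theorem SimpleGraph.binomialRandom_real_forall_mem {V : Type*} [Finite V] (p : unitInterval)
    {F : Finset (Sym2 V)} (hF : ∀ e ∈ F, ¬ e.IsDiag) :
    (binomialRandom V p).real {G | ∀ e ∈ F, e ∈ G.edgeSet} = p ^ F.card := by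
  have h := measureReal_biInter_eq_prod p (V := V) (E := fun e => {G | e ∈ G.edgeSet})
    (F := fun e => {e}) F (fun e _ G H h hG => by simpa [← h e] using hG)
    (fun e _ e' _ h => by simpa using h)
  have h1 : {G : SimpleGraph V | ∀ e ∈ F, e ∈ G.edgeSet} = ⋂ e ∈ F, {G | e ∈ G.edgeSet} := by
    ext; simp
  rw [h1, h, Finset.prod_congr rfl fun e he => binomialRandom_real_mem_edgeSet p (hF e he),
    Finset.prod_const]

/-! ### Probabilities of adjacency between sets and of common neighbours. -/

/-- The pairs with one end in `A` and the other in `B`. -/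
def SimpleGraph.crossPairs {V : Type*} [DecidableEq V] (A B : Finset V) : Finset (Sym2 V) :=
  (A ×ˢ B).image fun x => s(x.1, x.2)

theorem SimpleGraph.mem_crossPairs {V : Type*} [DecidableEq V] {A B : Finset V} {e : Sym2 V} :
    e ∈ crossPairs A B ↔ ∃ u ∈ A, ∃ v ∈ B, s(u, v) = e := by
  simp [crossPairs, and_assoc]

theorem SimpleGraph.not_isDiag_of_mem_crossPairs {V : Type*} [DecidableEq V] {A B : Finset V}
    (h : Disjoint A B) {e : Sym2 V} (he : e ∈ crossPairs A B) : ¬ e.IsDiag := by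
  obtain ⟨u, hu, v, hv, rfl⟩ := mem_crossPairs.1 he
  rintro (rfl : u = v)
  exact Finset.disjoint_left.1 h hu hv

theorem SimpleGraph.card_crossPairs {V : Type*} [DecidableEq V] {A B : Finset V}
    (h : Disjoint A B) : (crossPairs A B).card = A.card * B.card := by
  rw [crossPairs, Finset.card_image_of_injOn, Finset.card_product]
  rintro ⟨u, v⟩ hx ⟨u', v'⟩ hy hxy
  simp only [Finset.coe_product, Set.mem_prod, Finset.mem_coe] at hx hy
  simp only [Sym2.eq_iff] at hxy
  rcases hxy with ⟨rfl, rfl⟩ | ⟨rfl, rfl⟩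
  · rfl
  · exact absurd hy.2 (Finset.disjoint_left.1 h hx.1)

/-- Two disjoint sets fail to be joined by an edge of `G(n,p)` with probability
`(1 - p) ^ (|A| |B|)`. -/
theorem SimpleGraph.binomialRandom_real_not_exists_adj {V : Type*} [Finite V] (p : unitInterval)
    {A B : Finset V} (h : Disjoint A B) :
    (binomialRandom V p).real {G | ¬ ∃ u ∈ A, ∃ v ∈ B, G.Adj u v} =
      (1 - p : ℝ) ^ (A.card * B.card) := by
  classical
  rw [← card_crossPairs h, ← binomialRandom_real_forall_notMem p
    fun e he => not_isDiag_of_mem_crossPairs h he]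
  congr 1
  ext G
  simp only [Set.mem_ofPred_eq, mem_crossPairs, not_exists, not_and]
  constructor
  · rintro h _ ⟨u, hu, v, hv, rfl⟩
    exact h u hu v hv
  · exact fun h u hu v hv => h _ ⟨u, hu, v, hv, rfl⟩

theorem SimpleGraph.determinedBy_exists_adj {V : Type*} [DecidableEq V] (A B : Finset V) :
    DeterminedBy {G : SimpleGraph V | ∃ u ∈ A, ∃ v ∈ B, G.Adj u v} (crossPairs A B) := by
  rintro G H h ⟨u, hu, v, hv, huv⟩
  exact ⟨u, hu, v, hv, (h s(u, v) (mem_crossPairs.2 ⟨u, hu, v, hv, rfl⟩)).1 huv⟩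

/-- If `A i` and `B j` are pairwise disjoint sets of size at most `m`, then in `G(n,p)` each `A i`
is joined to each `B j` with probability at most `(1 - (1 - p) ^ m²) ^ (|I| |J|)`. -/
theorem SimpleGraph.binomialRandom_real_forall_exists_adj_le {V I J : Type*} [Finite V]
    [Fintype I] [Fintype J] (p : unitInterval) {m : ℕ} (A : I → Finset V) (B : J → Finset V)
    (hA : Pairwise fun i j => Disjoint (A i) (A j)) (hB : Pairwise fun i j => Disjoint (B i) (B j))
    (hAB : ∀ i j, Disjoint (A i) (B j)) (hAm : ∀ i, (A i).card ≤ m) (hBm : ∀ i, (B i).card ≤ m) :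
    (binomialRandom V p).real {G | ∀ i j, ∃ u ∈ A i, ∃ v ∈ B j, G.Adj u v} ≤
      (1 - (1 - p : ℝ) ^ (m ^ 2)) ^ (Fintype.card I * Fintype.card J) := by
  classical
  have h1 : {G : SimpleGraph V | ∀ i j, ∃ u ∈ A i, ∃ v ∈ B j, G.Adj u v} =
      ⋂ x ∈ (Finset.univ : Finset (I × J)), {G | ∃ u ∈ A x.1, ∃ v ∈ B x.2, G.Adj u v} := by
    ext G
    simp
  rw [h1, measureReal_biInter_eq_prod p (F := fun x : I × J => crossPairs (A x.1) (B x.2)) _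
    (fun x _ => determinedBy_exists_adj _ _), ← Fintype.card_prod, ← Finset.card_univ,
    ← Finset.prod_const]
  · refine Finset.prod_le_prod (fun _ _ => MeasureTheory.measureReal_nonneg) fun x _ => ?_
    have h2 := binomialRandom_real_not_exists_adj p (hAB x.1 x.2)
    have h3 : (binomialRandom V p).real {G | ∃ u ∈ A x.1, ∃ v ∈ B x.2, G.Adj u v} = 1 -
        (binomialRandom V p).real {G | ¬ ∃ u ∈ A x.1, ∃ v ∈ B x.2, G.Adj u v} := by
      rw [← MeasureTheory.probReal_compl_eq_one_sub .of_discrete]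
      congr 1
      ext G
      simp
    rw [h3, h2]
    gcongr 1 - ?_
    refine pow_le_pow_of_le_one (by linarith [p.2.2]) (by linarith [p.2.1]) ?_
    rw [sq]
    exact Nat.mul_le_mul (hAm _) (hBm _)
  · rintro ⟨i, j⟩ - ⟨i', j'⟩ - hne
    refine Finset.disjoint_left.2 fun e he he' => hne ?_
    obtain ⟨u, hu, v, hv, rfl⟩ := mem_crossPairs.1 he
    obtain ⟨u', hu', v', hv', h⟩ := mem_crossPairs.1 he'
    have hAi : ∀ {i j x}, x ∈ A i → x ∈ A j → i = j := fun {i j x} hi hj => by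
      by_contra hij
      exact Finset.disjoint_left.1 (hA hij) hi hj
    have hBi : ∀ {i j x}, x ∈ B i → x ∈ B j → i = j := fun {i j x} hi hj => by
      by_contra hij
      exact Finset.disjoint_left.1 (hB hij) hi hj
    rcases Sym2.eq_iff.1 h with ⟨rfl, rfl⟩ | ⟨rfl, rfl⟩
    · exact Prod.ext (hAi hu hu') (hBi hv hv')
    · exact absurd hv (Finset.disjoint_left.1 (hAB _ _) hu')

/-- In `G(n,p)`, the vertices `u`, `v` have no common neighbour in `S` with probability
`(1 - p²) ^ |S|`. -/
theorem SimpleGraph.binomialRandom_real_not_exists_common_adj {V : Type*} [Finite V]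
    (p : unitInterval) {S : Finset V} {u v : V} (huv : u ≠ v) (hu : u ∉ S) (hv : v ∉ S) :
    (binomialRandom V p).real {G | ¬ ∃ w ∈ S, G.Adj u w ∧ G.Adj v w} =
      (1 - (p : ℝ) ^ 2) ^ S.card := by
  classical
  have h1 : {G : SimpleGraph V | ¬ ∃ w ∈ S, G.Adj u w ∧ G.Adj v w} =
      ⋂ w ∈ S, {G | ¬ (G.Adj u w ∧ G.Adj v w)} := by
    ext G
    simp
  rw [h1, measureReal_biInter_eq_prod p (F := fun w => {s(u, w), s(v, w)}), ← Finset.prod_const]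
  · refine Finset.prod_congr rfl fun w hw => ?_
    have hF := binomialRandom_real_forall_mem p (F := {s(u, w), s(v, w)}) (by
      simp only [Finset.mem_insert, Finset.mem_singleton, forall_eq_or_imp, forall_eq,
        Sym2.mk_isDiag_iff]
      exact ⟨fun h => hu (h ▸ hw), fun h => hv (h ▸ hw)⟩)
    rw [Finset.card_pair (by
      rw [Ne, Sym2.congr_left]
      exact huv)] at hF
    rw [← hF, ← MeasureTheory.probReal_compl_eq_one_sub .of_discrete]
    congr 1
    ext G
    simp
  · intro w hw G H h hG
    have h2 := h s(u, w) (by simp)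
    have h3 := h s(v, w) (by simp)
    simp only [mem_edgeSet] at h2 h3
    simpa [h2, h3] using hG
  · intro w hw w' hw' hne
    refine Finset.disjoint_left.2 fun e he he' => hne ?_
    have : u ≠ w := fun h => hu (h ▸ hw)
    have : v ≠ w := fun h => hv (h ▸ hw)
    have : u ≠ w' := fun h => hu (h ▸ hw')
    have : v ≠ w' := fun h => hv (h ▸ hw')
    simp only [Finset.mem_insert, Finset.mem_singleton] at he he'
    rcases he with rfl | rfl <;> rcases he' with h | h <;>
      rcases Sym2.eq_iff.1 h with ⟨h1, h2⟩ | ⟨h1, h2⟩ <;> simp_all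

/-! ### Deterministic facts on brambles and clique minors. -/

/-- The pairwise disjoint branch sets of a clique minor form a bramble. -/
theorem SimpleGraph.hadwigerNumber_le_fractionalHadwigerNumber {V : Type*} [Finite V]
    (G : SimpleGraph V) : (G.hadwigerNumber : ℝ) ≤ G.fractionalHadwigerNumber := by
  classical
  obtain ⟨S, hc, hd, ha⟩ := G.isGreatest_hadwigerNumber.1
  generalize G.hadwigerNumber = t at S
  have hne : ∀ i, (S i).Nonempty := fun i => Set.nonempty_coe_sort.1 (hc i).nonempty
  have hinj : Function.Injective fun i => (⊤ : G.Subgraph).induce (S i) := by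
    intro i j hij
    by_contra hne'
    obtain ⟨x, hx⟩ := hne i
    have h2 : S i = S j := congrArg Subgraph.verts hij
    exact Set.disjoint_left.1 (hd i j hne') hx (h2 ▸ hx)
  refine G.isGreatest_fractionalHadwigerNumber.2
    ⟨Finset.univ.image fun i => (⊤ : G.Subgraph).induce (S i), ⟨?_, ?_⟩, fun _ => 1,
      fun _ _ => zero_le_one, ?_, ?_⟩
  · intro B hB
    obtain ⟨i, -, rfl⟩ := Finset.mem_image.1 hB
    exact connected_induce_iff.1 (hc i)
  · intro B hB B' hB'
    obtain ⟨i, -, rfl⟩ := Finset.mem_image.1 hB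
    obtain ⟨j, -, rfl⟩ := Finset.mem_image.1 hB'
    rcases eq_or_ne i j with rfl | hij
    · obtain ⟨x, hx⟩ := hne i
      exact Or.inl ⟨x, hx, hx⟩
    · exact Or.inr (ha i j hij)
  · intro v
    rw [Finset.sum_const, nsmul_eq_mul, mul_one]
    norm_cast
    rw [Finset.card_le_one]
    intro B hB B' hB'
    simp only [Finset.mem_filter, Finset.mem_image, Finset.mem_univ, true_and] at hB hB'
    obtain ⟨⟨i, rfl⟩, hi⟩ := hB
    obtain ⟨⟨j, rfl⟩, hj⟩ := hB'
    by_contra hij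
    exact Set.disjoint_left.1 (hd i j fun h => hij (by rw [h])) hi hj
  · rw [Finset.sum_const, Finset.card_image_of_injective _ hinj]
    simp

/-- Elements in several `t i` are counted repeatedly on the right. Nonnegativity is asked only on
the `t i`, since bramble weights are unconstrained off the bramble. -/
theorem Finset.sum_biUnion_le_sum_sum {ι α : Type*} [DecidableEq α] (s : Finset ι)
    (t : ι → Finset α) {f : α → ℝ} (hf : ∀ i ∈ s, ∀ a ∈ t i, 0 ≤ f a) :
    ∑ a ∈ s.biUnion t, f a ≤ ∑ i ∈ s, ∑ a ∈ t i, f a := by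
  classical
  induction s using Finset.induction_on with
  | empty => simp
  | insert i s hi ih =>
    have hf' : ∀ i ∈ s, ∀ a ∈ t i, 0 ≤ f a := fun j hj => hf j (mem_insert_of_mem hj)
    rw [biUnion_insert, sum_insert hi]
    have h := sum_union_inter (s₁ := t i) (s₂ := s.biUnion t) (f := f)
    have h2 : 0 ≤ ∑ a ∈ t i ∩ s.biUnion t, f a := sum_nonneg fun a ha =>
      hf i (mem_insert_self _ _) a (mem_inter.1 ha).1
    linarith [ih hf']

open Classical in
/-- A weighted bramble of total weight `h` on `n` vertices contains at least
`(h - n / (m + 1)) / m` pairwise disjoint members with at most `m` vertices. -/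
theorem SimpleGraph.IsBramble.exists_pairwiseDisjoint_le {V : Type*} [Fintype V]
    {G : SimpleGraph V} {ℬ : Finset G.Subgraph} (hℬ : G.IsBramble ℬ) {w : G.Subgraph → ℝ}
    (hw : ∀ B ∈ ℬ, 0 ≤ w B) (hw1 : ∀ v : V, ∑ B ∈ ℬ with v ∈ B.verts, w B ≤ 1) (m : ℕ) :
    ∃ F ⊆ ℬ, (F : Set G.Subgraph).PairwiseDisjoint Subgraph.verts ∧
      (∀ B ∈ F, B.verts.toFinset.card ≤ m) ∧
      ∑ B ∈ ℬ, w B ≤ Fintype.card V / (m + 1) + m * F.card := by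
  obtain ⟨F, hF⟩ : ∃ F, Maximal (fun F : Finset G.Subgraph => F ⊆ ℬ ∧
      (F : Set G.Subgraph).PairwiseDisjoint Subgraph.verts ∧
      ∀ B ∈ F, B.verts.toFinset.card ≤ m) F :=
    Set.Finite.exists_maximal (Set.toFinite _)
      ⟨∅, Finset.empty_subset _, by simp, fun B hB => absurd hB (Finset.notMem_empty B)⟩
  obtain ⟨⟨hFℬ, hFd, hFm⟩, hmax⟩ := hF
  refine ⟨F, hFℬ, hFd, hFm, ?_⟩
  rw [← Finset.sum_filter_add_sum_filter_not ℬ fun B => m < B.verts.toFinset.card]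
  gcongr ?_ + ?_
  -- Double counting: `∑ w B |B|` is the sum over vertices of the weight through them, at most the
  -- number of vertices.
  · rw [le_div_iff₀ (by positivity), Finset.sum_mul]
    calc ∑ B ∈ ℬ with m < B.verts.toFinset.card, w B * (m + 1)
        ≤ ∑ B ∈ ℬ with m < B.verts.toFinset.card, w B * B.verts.toFinset.card := by
          refine Finset.sum_le_sum fun B hB => ?_
          rw [Finset.mem_filter] at hB
          exact mul_le_mul_of_nonneg_left (by exact_mod_cast hB.2) (hw B hB.1)
      _ ≤ ∑ B ∈ ℬ, w B * B.verts.toFinset.card :=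
          Finset.sum_le_sum_of_subset_of_nonneg (Finset.filter_subset _ _)
            fun B hB _ => mul_nonneg (hw B hB) (Nat.cast_nonneg _)
      _ = ∑ B ∈ ℬ, ∑ v : V, if v ∈ B.verts then w B else 0 := by
          refine Finset.sum_congr rfl fun B _ => ?_
          rw [← Finset.sum_filter, Finset.sum_const, nsmul_eq_mul, mul_comm]
          congr 3
          ext v
          simp
      _ = ∑ v : V, ∑ B ∈ ℬ with v ∈ B.verts, w B := by
          rw [Finset.sum_comm]
          simp only [Finset.sum_filter]
      _ ≤ ∑ v : V, 1 := Finset.sum_le_sum fun v _ => hw1 v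
      _ = Fintype.card V := by simp
  -- By maximality every small member meets a member of `F`. The members of `F` cover at most `m *
  -- F.card` vertices, each carrying weight at most `1`.
  · calc ∑ B ∈ ℬ with ¬ m < B.verts.toFinset.card, w B
        ≤ ∑ B ∈ F.biUnion fun C => C.verts.toFinset.biUnion fun v =>
            ℬ.filter fun B => v ∈ B.verts, w B := by
          refine Finset.sum_le_sum_of_subset_of_nonneg ?_ fun B hB _ => ?_
          · intro B hB
            obtain ⟨hB1, hB2⟩ := Finset.mem_filter.1 hB
            simp only [Finset.mem_biUnion, Finset.mem_filter, Set.mem_toFinset]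
            by_contra hcon
            push Not at hcon
            have hBF : B ∉ F := fun h => by
              obtain ⟨v, hv⟩ := (hℬ.1 B hB1).nonempty
              exact hcon B h v hv hB1 hv
            refine hBF (hmax (y := insert B F) ⟨?_, ?_, ?_⟩ (Finset.subset_insert _ _)
              (Finset.mem_insert_self _ _))
            · exact Finset.insert_subset hB1 hFℬ
            · rw [Finset.coe_insert]
              refine hFd.insert fun C hC _ => ?_
              exact Set.disjoint_left.2 fun v hvB hvC => hcon C hC v hvC hB1 hvB
            · intro C hC
              rcases Finset.mem_insert.1 hC with rfl | hC
              · omega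
              · exact hFm C hC
          · simp only [Finset.mem_biUnion, Finset.mem_filter] at hB
            obtain ⟨_, _, _, _, hB, _⟩ := hB
            exact hw B hB
      _ ≤ ∑ C ∈ F, ∑ B ∈ C.verts.toFinset.biUnion fun v => ℬ.filter fun B => v ∈ B.verts, w B :=
          Finset.sum_biUnion_le_sum_sum _ _ fun C _ B hB => by
            simp only [Finset.mem_biUnion, Finset.mem_filter] at hB
            obtain ⟨_, _, hB, _⟩ := hB
            exact hw B hB
      _ ≤ ∑ C ∈ F, ∑ v ∈ C.verts.toFinset, ∑ B ∈ ℬ with v ∈ B.verts, w B := by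
          refine Finset.sum_le_sum fun C _ => Finset.sum_biUnion_le_sum_sum _ _ fun v _ B hB => ?_
          exact hw B (Finset.mem_filter.1 hB).1
      _ ≤ ∑ C ∈ F, ∑ v ∈ C.verts.toFinset, 1 :=
          Finset.sum_le_sum fun C _ => Finset.sum_le_sum fun v _ => hw1 v
      _ ≤ ∑ C ∈ F, (m : ℝ) := by
          refine Finset.sum_le_sum fun C hC => ?_
          simpa using hFm C hC
      _ = m * F.card := by simp [mul_comm]

/-- If any two vertices of a nonempty set have a common neighbour in the set, the set induces a
connected subgraph. -/
theorem SimpleGraph.connected_induce_of_forall_common_adj {V : Type*} {G : SimpleGraph V}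
    {S : Set V} (hS : S.Nonempty)
    (h : ∀ u ∈ S, ∀ v ∈ S, u ≠ v → ∃ w ∈ S, G.Adj u w ∧ G.Adj v w) : (G.induce S).Connected := by
  have : Nonempty S := hS.to_subtype
  refine Connected.mk ?_
  rintro ⟨u, hu⟩ ⟨v, hv⟩
  rcases eq_or_ne u v with rfl | huv
  · exact Reachable.refl _
  · obtain ⟨w, hw, huw, hvw⟩ := h u hu v hv huv
    have h1 : (G.induce S).Adj ⟨u, hu⟩ ⟨w, hw⟩ := huw
    have h2 : (G.induce S).Adj ⟨w, hw⟩ ⟨v, hv⟩ := hvw.symm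
    exact h1.reachable.trans h2.reachable

/-- Deleting a branch set for each defect of a would-be clique minor leaves a clique minor. -/
theorem SimpleGraph.card_le_hadwigerNumber_add_card {V I : Type*} [Finite V] [Fintype I]
    [LinearOrder I] {G : SimpleGraph V} (S : I → Set V)
    (hS : Pairwise fun i j => Disjoint (S i) (S j)) (D : Finset (I ⊕ I × I))
    (hD : ∀ i, Sum.inl i ∉ D → (G.induce (S i)).Connected)
    (hD2 : ∀ i j, i < j → Sum.inr (i, j) ∉ D → ∃ u ∈ S i, ∃ v ∈ S j, G.Adj u v) :
    Fintype.card I ≤ G.hadwigerNumber + D.card := by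
  classical
  obtain ⟨T, hTc, hT⟩ : ∃ T : Finset I, Fintype.card I ≤ T.card + D.card ∧
      ∀ i ∈ T, ∀ x ∈ D, Sum.elim id Prod.fst x ≠ i := by
    -- Each defect is charged to one index: the set itself, or the first index of the pair.
    refine ⟨(D.image (Sum.elim id Prod.fst))ᶜ, ?_, fun i hi x hx h => ?_⟩
    · have h1 : (D.image (Sum.elim id Prod.fst)).card ≤ D.card := Finset.card_image_le
      have h2 := Finset.card_add_card_compl (D.image (Sum.elim id Prod.fst))
      omega
    · exact Finset.mem_compl.1 hi (Finset.mem_image.2 ⟨x, hx, h⟩)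
  refine hTc.trans (Nat.add_le_add_right (G.isGreatest_hadwigerNumber.2 ?_) _)
  let f := T.equivFin.symm
  have hadj : ∀ i j : I, i ∈ T → i < j → ∃ u ∈ S i, ∃ v ∈ S j, G.Adj u v :=
    fun i j hi hij => hD2 i j hij fun h => hT i hi _ h rfl
  refine ⟨fun i => S (f i), fun i => ?_, fun i j hij => ?_, fun i j hij => ?_⟩
  · exact hD _ fun h => hT _ (f i).2 _ h rfl
  · exact hS fun h => hij (f.injective (Subtype.ext h))
  · have hij' : (f i : I) ≠ f j := fun h => hij (f.injective (Subtype.ext h))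
    rcases lt_or_gt_of_ne hij' with h | h
    · exact hadj _ _ (f i).2 h
    · obtain ⟨u, hu, v, hv, huv⟩ := hadj _ _ (f j).2 h
      exact ⟨v, hv, u, hu, huv.symm⟩

/-! ### First-moment and union bounds for fixed `n`. -/

open MeasureTheory in
/-- Markov's inequality for the number of events that occur. -/
theorem MeasureTheory.mul_measureReal_le_card_filter {Ω J : Type*} [MeasurableSpace Ω]
    [DiscreteMeasurableSpace Ω] (μ : Measure Ω) [IsFiniteMeasure μ] [Fintype J] (E : J → Set Ω)
    [∀ ω, DecidablePred fun j => ω ∈ E j] (c : ℝ) :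
    c * μ.real {ω | c ≤ (Finset.univ.filter fun j => ω ∈ E j).card} ≤ ∑ j, μ.real (E j) := by
  have hf : (fun ω => ∑ j, (E j).indicator (1 : Ω → ℝ) ω) =
      fun ω => ((Finset.univ.filter fun j => ω ∈ E j).card : ℝ) := by
    ext ω
    simp [Set.indicator_apply]
  have hi : ∀ j, Integrable ((E j).indicator (1 : Ω → ℝ)) μ := fun j =>
    (integrable_const 1).indicator .of_discrete
  have h := mul_meas_ge_le_integral_of_nonneg (μ := μ)
    (f := fun ω => ∑ j, (E j).indicator (1 : Ω → ℝ) ω)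
    (Filter.Eventually.of_forall fun ω => Finset.sum_nonneg fun j _ =>
      Set.indicator_nonneg (fun _ _ => zero_le_one) _)
    (integrable_finsetSum _ fun j _ => hi j) c
  rw [integral_finsetSum _ fun j _ => hi j] at h
  simp only [integral_indicator_one (MeasurableSet.of_discrete)] at h
  simp only [congrFun hf] at h
  exact h

/-- A union bound over ordered pairs lacking a common neighbour inside `S`. It is crude but decays
geometrically in the size of `S`, which is all that is needed. -/
theorem SimpleGraph.binomialRandom_real_not_connected_le {V : Type*} [Finite V] (p : unitInterval)
    {S : Finset V} (hS : S.Nonempty) :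
    (binomialRandom V p).real {G | ¬ (G.induce (S : Set V)).Connected} ≤
      (S.card : ℝ) ^ 2 * (1 - (p : ℝ) ^ 2) ^ (S.card - 2) := by
  classical
  have hp : 0 ≤ 1 - (p : ℝ) ^ 2 := by nlinarith [p.2.1, p.2.2]
  calc (binomialRandom V p).real {G | ¬ (G.induce (S : Set V)).Connected}
      ≤ (binomialRandom V p).real (⋃ x ∈ S.offDiag,
          {G | ¬ ∃ w ∈ (S.erase x.1).erase x.2, G.Adj x.1 w ∧ G.Adj x.2 w}) := by
        refine MeasureTheory.measureReal_mono (fun G hG => ?_) (MeasureTheory.measure_ne_top _ _)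
        by_contra hcon
        refine hG (connected_induce_of_forall_common_adj (by simpa using hS) ?_)
        intro u hu v hv huv
        simp only [Set.mem_iUnion, Set.mem_ofPred_eq, exists_prop,
          not_exists (p := fun x => x ∈ S.offDiag ∧ _), not_and, not_not] at hcon
        obtain ⟨w, hw, h⟩ := hcon (u, v) (Finset.mem_offDiag.2 ⟨hu, hv, huv⟩)
        exact ⟨w, Finset.mem_of_mem_erase (Finset.mem_of_mem_erase hw), h⟩
    _ ≤ ∑ x ∈ S.offDiag, (binomialRandom V p).real
          {G | ¬ ∃ w ∈ (S.erase x.1).erase x.2, G.Adj x.1 w ∧ G.Adj x.2 w} :=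
        MeasureTheory.measureReal_biUnion_finset_le _ _
    _ = ∑ x ∈ S.offDiag, (1 - (p : ℝ) ^ 2) ^ (S.card - 2) := by
        refine Finset.sum_congr rfl fun x hx => ?_
        obtain ⟨h1, h2, h3⟩ := Finset.mem_offDiag.1 hx
        rw [binomialRandom_real_not_exists_common_adj p h3 (by simp) (by simp),
          Finset.card_erase_of_mem (Finset.mem_erase.2 ⟨h3.symm, h2⟩),
          Finset.card_erase_of_mem h1]
        congr 1
    _ ≤ _ := by
        rw [Finset.sum_const, nsmul_eq_mul, Finset.offDiag_card]
        gcongr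
        rw [sq]
        exact_mod_cast Nat.sub_le _ _

/-- With `t` disjoint candidate branch sets of size `s`, the probability that the Hadwiger number
of `G(n,p)` falls short of `t` by at least `c`. -/
theorem SimpleGraph.mul_binomialRandom_real_hadwigerNumber_le {V : Type*} [Finite V]
    (p : unitInterval) {s t : ℕ} (hs : 0 < s) (S : Fin t → Finset V)
    (hS : Pairwise fun i j => Disjoint (S i) (S j)) (hcard : ∀ i, (S i).card = s) (c : ℝ) :
    c * (binomialRandom V p).real {G | (G.hadwigerNumber : ℝ) ≤ t - c} ≤
      t * (s ^ 2 * (1 - (p : ℝ) ^ 2) ^ (s - 2)) + t ^ 2 * (1 - (p : ℝ)) ^ (s ^ 2) := by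
  classical
  rcases lt_or_ge c 0 with hc | hc
  · refine (mul_nonpos_of_nonpos_of_nonneg hc.le MeasureTheory.measureReal_nonneg).trans ?_
    have h1 : 0 ≤ 1 - (p : ℝ) ^ 2 := by nlinarith [p.2.1, p.2.2]
    have h2 : 0 ≤ 1 - (p : ℝ) := by linarith [p.2.2]
    positivity
  -- The condition `x.1 < x.2` empties the event on the diagonal, where the two sets are not
  -- disjoint and the non-adjacency estimate does not apply.
  let E : Fin t ⊕ Fin t × Fin t → Set (SimpleGraph V) :=
    Sum.elim (fun i => {G | ¬ (G.induce (S i : Set V)).Connected})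
      fun x => {G | x.1 < x.2 ∧ ¬ ∃ u ∈ S x.1, ∃ v ∈ S x.2, G.Adj u v}
  calc c * (binomialRandom V p).real {G | (G.hadwigerNumber : ℝ) ≤ t - c}
      ≤ c * (binomialRandom V p).real
          {G | c ≤ (Finset.univ.filter fun j => G ∈ E j).card} := by
        refine mul_le_mul_of_nonneg_left (MeasureTheory.measureReal_mono fun G hG => ?_) hc
        have h := card_le_hadwigerNumber_add_card (G := G) (fun i => (S i : Set V))
          (fun i j hij => by simpa using hS hij) (Finset.univ.filter fun j => G ∈ E j)
          (fun i hi => by simpa [E] using hi)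
          (fun i j hij h => by
            simp only [E, Finset.mem_filter, Finset.mem_univ, true_and, Sum.elim_inr,
              Set.mem_ofPred_eq, hij, not_not] at h
            exact h)
        rw [Fintype.card_fin] at h
        have h' : (t : ℝ) ≤ G.hadwigerNumber + (Finset.univ.filter fun j => G ∈ E j).card := by
          exact_mod_cast h
        simp only [Set.mem_ofPred_eq] at hG ⊢
        linarith
    _ ≤ ∑ j, (binomialRandom V p).real (E j) :=
        MeasureTheory.mul_measureReal_le_card_filter _ _ _
    _ ≤ ∑ i : Fin t, (s ^ 2 * (1 - (p : ℝ) ^ 2) ^ (s - 2)) +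
          ∑ x : Fin t × Fin t, (1 - (p : ℝ)) ^ (s ^ 2) := by
        rw [Fintype.sum_sum_type]
        gcongr with i _ x _
        · rw [← hcard i]
          exact binomialRandom_real_not_connected_le p (Finset.card_pos.1 (by rw [hcard]; exact hs))
        · by_cases h : x.1 < x.2
          · have h2 := binomialRandom_real_not_exists_adj p (hS h.ne)
            rw [hcard, hcard, ← sq] at h2
            rw [← h2]
            exact MeasureTheory.measureReal_mono fun G hG => hG.2
          · have h2 : 0 ≤ 1 - (p : ℝ) := by linarith [p.2.2]
            have h3 : E (Sum.inr x) = ∅ := by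
              ext G
              simp [E, h]
            rw [h3, MeasureTheory.measureReal_empty]
            positivity
    _ = _ := by simp [sq]

theorem Fin.exists_pairwise_disjoint_card_eq {n s t : ℕ} (h : t * s ≤ n) :
    ∃ S : Fin t → Finset (Fin n), (Pairwise fun i j => Disjoint (S i) (S j)) ∧
      ∀ i, (S i).card = s := by
  let f : Fin t × Fin s ↪ Fin n := finProdFinEquiv.toEmbedding.trans (Fin.castLEEmb h)
  refine ⟨fun i => Finset.univ.map ((Function.Embedding.sectR i (Fin s)).trans f),
    fun i j hij => ?_, fun i => by simp⟩
  refine Finset.disjoint_left.2 fun x hx hy => hij ?_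
  obtain ⟨a, -, rfl⟩ := Finset.mem_map.1 hx
  obtain ⟨b, -, hb⟩ := Finset.mem_map.1 hy
  exact (congrArg Prod.fst (f.injective hb)).symm

/-- Union bound over all choices of two families of `k` vertex sets of size at most `m`. -/
theorem SimpleGraph.binomialRandom_real_exists_disjoint_adj_le {n : ℕ} (p : unitInterval)
    (m k : ℕ) :
    (binomialRandom (Fin n) p).real {G | ∃ S : Fin k ⊕ Fin k → Finset (Fin n),
      (∀ i, (S i).Nonempty ∧ (S i).card ≤ m) ∧ (Pairwise fun i j => Disjoint (S i) (S j)) ∧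
        Pairwise fun i j => ∃ u ∈ S i, ∃ v ∈ S j, G.Adj u v} ≤
      (n : ℝ) ^ (2 * k * m) * (1 - (1 - (p : ℝ)) ^ (m ^ 2)) ^ (k ^ 2) := by
  classical
  have hp : 0 ≤ 1 - (1 - (p : ℝ)) ^ (m ^ 2) := by
    have := pow_le_one₀ (n := m ^ 2) (by linarith [p.2.2] : 0 ≤ 1 - (p : ℝ)) (by linarith [p.2.1])
    linarith
  -- Nonempty sets of size at most `m` are images of maps from `Fin m`, so there are at most `n ^ m`
  -- choices for each of the `2k` sets. Only the `k²` adjacencies across the two families are then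
  -- used.
  let R : (Fin m → Fin n) → Finset (Fin n) := fun g => Finset.univ.image g
  have hR : ∀ A : Finset (Fin n), A.Nonempty → A.card ≤ m → ∃ g, R g = A := by
    intro A hA hAm
    have : Nonempty A := hA.to_subtype
    obtain ⟨e⟩ : Nonempty (A ↪ Fin m) :=
      Function.Embedding.nonempty_of_card_le (by simpa using hAm)
    refine ⟨fun i => (Function.invFun e i : A), ?_⟩
    ext x
    simp only [R, Finset.mem_image, Finset.mem_univ, true_and]
    constructor
    · rintro ⟨i, rfl⟩
      exact Subtype.property _
    · intro hx
      exact ⟨e ⟨x, hx⟩, by rw [Function.leftInverse_invFun e.injective]⟩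
  calc _ ≤ (binomialRandom (Fin n) p).real (⋃ g ∈ (Finset.univ : Finset
        (Fin k ⊕ Fin k → Fin m → Fin n)), {G | (Pairwise fun i j => Disjoint (R (g i)) (R (g j))) ∧
          ∀ i j, ∃ u ∈ R (g (Sum.inl i)), ∃ v ∈ R (g (Sum.inr j)), G.Adj u v}) := by
        refine MeasureTheory.measureReal_mono ?_ (MeasureTheory.measure_ne_top _ _)
        rintro G ⟨S, hS, hd, ha⟩
        choose g hg using fun i => hR (S i) (hS i).1 (hS i).2
        simp only [Set.mem_iUnion, Set.mem_ofPred_eq, Finset.mem_univ, exists_prop, true_and]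
        refine ⟨g, ?_, fun i j => ?_⟩
        · simpa only [hg] using hd
        · simpa only [hg] using ha (Sum.inl_ne_inr (a := i) (b := j))
    _ ≤ _ := MeasureTheory.measureReal_biUnion_finset_le _ _
    _ ≤ ∑ g : Fin k ⊕ Fin k → Fin m → Fin n, (1 - (1 - (p : ℝ)) ^ (m ^ 2)) ^ (k ^ 2) := by
        refine Finset.sum_le_sum fun g _ => ?_
        by_cases hd : Pairwise fun i j => Disjoint (R (g i)) (R (g j))
        · have hRm : ∀ g, (R g).card ≤ m := fun g => Finset.card_image_le.trans (by simp)
          have h := binomialRandom_real_forall_exists_adj_le p (fun i => R (g (Sum.inl i)))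
            (fun i => R (g (Sum.inr i))) (fun i j hij => hd (Sum.inl_injective.ne hij))
            (fun i j hij => hd (Sum.inr_injective.ne hij)) (fun i j => hd Sum.inl_ne_inr)
            (fun _ => hRm _) (fun _ => hRm _)
          rw [Fintype.card_fin, ← sq] at h
          refine le_trans (MeasureTheory.measureReal_mono fun G hG => hG.2) h
        · simp only [hd, false_and, Set.ofPred_false, MeasureTheory.measureReal_empty]
          positivity
    _ = _ := by
        rw [Finset.sum_const, nsmul_eq_mul, Finset.card_univ]
        simp only [Fintype.card_pi, Fintype.card_fin, Finset.prod_const, Finset.card_univ,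
          Fintype.card_sum]
        push_cast
        rw [← pow_mul]
        ring_nf

/-- So large a weight forces `2 * k` disjoint small members of a bramble. Being disjoint, they can
touch only through edges. -/
theorem SimpleGraph.binomialRandom_real_lt_fractionalHadwigerNumber_le {n : ℕ}
    (p : unitInterval) (m k : ℕ) :
    (binomialRandom (Fin n) p).real
        {G | (n : ℝ) / (m + 1) + m * (2 * k) < G.fractionalHadwigerNumber} ≤
      (n : ℝ) ^ (2 * k * m) * (1 - (1 - (p : ℝ)) ^ (m ^ 2)) ^ (k ^ 2) := by
  classical
  refine le_trans (MeasureTheory.measureReal_mono fun G hG => ?_)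
    (binomialRandom_real_exists_disjoint_adj_le p m k)
  obtain ⟨ℬ, hℬ, w, hw, hw1, h⟩ := G.isGreatest_fractionalHadwigerNumber.1
  obtain ⟨F, hFℬ, hFd, hFm, hle⟩ := hℬ.exists_pairwiseDisjoint_le hw hw1 m
  rw [Set.mem_ofPred_eq, h] at hG
  have hk : 2 * k ≤ F.card := by
    by_contra! hcon
    have h1 : (F.card : ℝ) ≤ 2 * k := by exact_mod_cast hcon.le
    have h2 : (m : ℝ) * F.card ≤ m * (2 * k) := by gcongr
    rw [Fintype.card_fin] at hle
    linarith
  obtain ⟨e⟩ : Nonempty (Fin k ⊕ Fin k ↪ F) :=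
    Function.Embedding.nonempty_of_card_le (by simpa [← two_mul] using hk)
  have hdis : Pairwise fun i j => Disjoint (e i).1.verts (e j).1.verts := fun i j hij =>
    hFd (e i).2 (e j).2 fun h => hij (e.injective (Subtype.ext h))
  refine ⟨fun i => (e i).1.verts.toFinset, fun i => ⟨?_, ?_⟩, fun i j hij => ?_,
    fun i j hij => ?_⟩
  · obtain ⟨v, hv⟩ := (hℬ.1 _ (hFℬ (e i).2)).nonempty
    exact ⟨v, by simpa using hv⟩
  · convert hFm _ (e i).2
  · simpa using hdis hij
  · rcases hℬ.2 _ (hFℬ (e i).2) _ (hFℬ (e j).2) with ⟨v, hv, hv'⟩ | ⟨u, hu, v, hv, huv⟩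
    · exact absurd hv' (Set.disjoint_left.1 (hdis hij) hv)
    · exact ⟨u, by simpa using hu, v, by simpa using hv, huv⟩

/-! ### Asymptotics of the upper and lower bounds. -/

open Filter Topology

/-- With `x = log n` and `z = n ^ (-α) ≤ q ^ (m²)`, the logarithm of the left side is at most `k
(2mx - kz)`. As `k` is about `c n / log_b n`, `kz` has order `n ^ (1 - α) / log_b n` and outgrows
`2mx + x`; `hbig` makes this quantitative. -/
theorem one_sub_pow_mul_le_inv {n m k : ℕ} {l c α q : ℝ} (hq : q = Real.exp (-l))
    (hl : 0 < l) (hn : 1 ≤ n) (hL : 1 ≤ Real.log n / l)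
    (hm : (m : ℝ) ≤ √(Real.log n / l)) (hm2 : (m : ℝ) ^ 2 ≤ α * (Real.log n / l))
    (hk : c * (n / (Real.log n / l)) - 1 ≤ k)
    (hbig : Real.log n / l * (2 * (Real.log n / l) * Real.log n + Real.log n + 1) ≤
      c * Real.exp ((1 - α) * Real.log n)) :
    (n : ℝ) ^ (2 * k * m) * (1 - q ^ (m ^ 2)) ^ (k ^ 2) ≤ (n : ℝ)⁻¹ := by
  set x := Real.log n with hx
  have hx0 : 0 < x := by
    have := mul_pos (lt_of_lt_of_le one_pos hL) hl
    rwa [div_mul_cancel₀ _ hl.ne'] at this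
  have hnx : (n : ℝ) = Real.exp x := (Real.exp_log (by exact_mod_cast hn)).symm
  obtain ⟨L, hLx⟩ : ∃ L, L = x / l := ⟨_, rfl⟩
  rw [← hLx] at hL hm hm2 hk hbig
  have hxl : x = L * l := by rw [hLx, div_mul_cancel₀ _ hl.ne']
  have hL0 : 0 < L := by linarith
  set z := Real.exp (-(α * x)) with hz
  have hz0 : 0 < z := Real.exp_pos _
  have hz1 : z ≤ q ^ (m ^ 2) := by
    rw [hq, ← Real.exp_nat_mul, hz, Real.exp_le_exp]
    push_cast
    rw [hxl]
    nlinarith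
  have hq1 : q ^ (m ^ 2) ≤ 1 := by
    rw [hq]
    exact pow_le_one₀ (Real.exp_pos _).le (Real.exp_le_one_iff.2 (by linarith))
  have hmL : (m : ℝ) ≤ L := hm.trans (Real.sqrt_le_left hL0.le |>.2 (by nlinarith))
  have hnz : (n : ℝ) * z = Real.exp ((1 - α) * x) := by
    rw [hnx, hz, ← Real.exp_add]
    ring_nf
  -- The `+ 1` in `hbig` pays for rounding `k` down, as `z ≤ 1`.
  have hkz : 2 * m * x + x ≤ k * z := by
    have h1 : z * (c * (n / L) - 1) ≤ z * k := mul_le_mul_of_nonneg_left hk hz0.le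
    have h2 : 2 * L * x + x + 1 ≤ c * (n * z) / L := by
      rw [le_div_iff₀ hL0, hnz]
      linarith
    have h3 : z * (c * (n / L)) = c * (n * z) / L := by ring
    have h4 : z ≤ 1 := hz1.trans hq1
    have h5 : 2 * m * x ≤ 2 * L * x := by gcongr
    nlinarith
  have hk1 : (1 : ℝ) ≤ k := by
    have h1 : 0 < (k : ℝ) * z := lt_of_lt_of_le (by positivity) hkz
    have h2 : k ≠ 0 := by
      rintro rfl
      simp at h1
    exact_mod_cast Nat.one_le_iff_ne_zero.2 h2
  calc (n : ℝ) ^ (2 * k * m) * (1 - q ^ (m ^ 2)) ^ (k ^ 2)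
      ≤ Real.exp x ^ (2 * k * m) * Real.exp (-z) ^ (k ^ 2) := by
        rw [hnx]
        gcongr
        linarith [Real.add_one_le_exp (-z)]
    _ = Real.exp (k * (2 * m * x - k * z)) := by
        rw [← Real.exp_nat_mul, ← Real.exp_nat_mul, ← Real.exp_add]
        congr 1
        push_cast
        ring
    _ ≤ Real.exp (-x) := by
        rw [Real.exp_le_exp]
        nlinarith
    _ = (n : ℝ)⁻¹ := by rw [hnx, Real.exp_neg]

theorem SimpleGraph.tendsto_binomialRandom_real_lt_fractionalHadwigerNumber (p : unitInterval)
    {l : ℝ} (hl : 0 < l) (hpl : 1 - (p : ℝ) = Real.exp (-l)) {ε : ℝ} (hε : 0 < ε) :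
    Tendsto (fun n : ℕ => (binomialRandom (Fin n) p).real
      {G | (1 + ε) * (n / √(Real.log n / l)) < G.fractionalHadwigerNumber}) atTop (𝓝 0) := by
  -- Chosen so that `m ≤ r / (1 + ε / 2)` gives `m² ≤ α r²`.
  set α : ℝ := ((1 + ε / 2) ^ 2)⁻¹ with hα
  have hα1 : α < 1 := inv_lt_one_of_one_lt₀ (by nlinarith)
  have hlog : Tendsto (fun n : ℕ => Real.log n) atTop atTop :=
    Real.tendsto_log_atTop.comp tendsto_natCast_atTop_atTop
  have hbig : ∀ᶠ x : ℝ in atTop, x / l * (2 * (x / l) * x + x + 1) ≤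
      ε / 4 * Real.exp ((1 - α) * x) := by
    have h := (isLittleO_pow_exp_pos_mul_atTop 3 (sub_pos.2 hα1)).bound
      (c := ε / 4 / (1 / l * (2 / l + 2))) (by positivity)
    filter_upwards [h, eventually_ge_atTop 1] with x hx hx1
    rw [Real.norm_of_nonneg (by positivity), Real.norm_of_nonneg (by positivity), div_mul_eq_mul_div,
      le_div_iff₀ (by positivity)] at hx
    refine le_trans ?_ hx
    have h1 : x / l * (2 * (x / l) * x + x + 1) = 1 / l * (2 / l * x ^ 3 + (x ^ 2 + x)) := by ring
    have h2 : x ^ 3 * (1 / l * (2 / l + 2)) = 1 / l * (2 / l * x ^ 3 + 2 * x ^ 3) := by ring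
    rw [h1, h2]
    gcongr
    nlinarith [mul_nonneg (sub_nonneg.2 hx1) (sq_nonneg x), mul_nonneg (sub_nonneg.2 hx1)
      (by linarith : 0 ≤ x)]
  refine squeeze_zero' (Eventually.of_forall fun n => MeasureTheory.measureReal_nonneg) ?_
    (tendsto_inv_atTop_zero.comp tendsto_natCast_atTop_atTop)
  filter_upwards [hlog.eventually hbig, hlog.eventually (eventually_ge_atTop l),
    eventually_ge_atTop 1] with n hn hnl hn1
  have hL : 1 ≤ Real.log n / l := (one_le_div hl).2 hnl
  have hr0 : 0 < √(Real.log n / l) := Real.sqrt_pos.2 (by linarith)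
  have hr2 : √(Real.log n / l) * √(Real.log n / l) = Real.log n / l :=
    Real.mul_self_sqrt (by linarith)
  set r := √(Real.log n / l) with hr
  -- The error `ε` is split in half: `n / (m + 1)` is at most `(1 + ε / 2) n / r`, with no rounding
  -- loss thanks to the `+ 1`, and `2km` is at most `(ε / 2) n / r`.
  have hm : ((⌊r / (1 + ε / 2)⌋₊ : ℕ) : ℝ) ≤ r / (1 + ε / 2) := Nat.floor_le (by positivity)
  have hm' : r / (1 + ε / 2) < (⌊r / (1 + ε / 2)⌋₊ : ℕ) + 1 := Nat.lt_floor_add_one _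
  have hk : ((⌊ε / 4 * (n / (Real.log n / l))⌋₊ : ℕ) : ℝ) ≤ ε / 4 * (n / (Real.log n / l)) :=
    Nat.floor_le (by positivity)
  have hk' := Nat.lt_floor_add_one (ε / 4 * (n / (Real.log n / l)))
  generalize ⌊r / (1 + ε / 2)⌋₊ = m at hm hm'
  generalize ⌊ε / 4 * (n / (Real.log n / l))⌋₊ = k at hk hk'
  have hmr : (m : ℝ) ≤ r := hm.trans (div_le_self hr0.le (by linarith))
  refine le_trans (MeasureTheory.measureReal_mono fun G hG => ?_)
    ((binomialRandom_real_lt_fractionalHadwigerNumber_le p m k).trans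
      (one_sub_pow_mul_le_inv hpl hl hn1 hL hmr ?_ (by linarith) hn))
  · rw [Set.mem_ofPred_eq] at hG ⊢
    refine lt_of_le_of_lt ?_ hG
    have h1 : (n : ℝ) / (m + 1) ≤ (1 + ε / 2) * (n / r) := by
      calc (n : ℝ) / (m + 1) ≤ n / (r / (1 + ε / 2)) := by gcongr
        _ = _ := by field_simp
    have h2 : (m : ℝ) * (2 * k) ≤ ε / 2 * (n / r) := by
      calc (m : ℝ) * (2 * k) ≤ r * (2 * (ε / 4 * (n / (Real.log n / l)))) := by gcongr
        _ = _ := by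
          rw [← hr2]
          field_simp
          ring
    linarith
  · calc (m : ℝ) ^ 2 ≤ (r / (1 + ε / 2)) ^ 2 := by gcongr
      _ = α * (Real.log n / l) := by
        rw [← hr2, hα]
        field_simp

theorem SimpleGraph.tendsto_binomialRandom_real_hadwigerNumber_lt (p : unitInterval)
    (hp0 : 0 < (p : ℝ)) {l : ℝ} (hl : 0 < l) (hpl : 1 - (p : ℝ) = Real.exp (-l)) {ε : ℝ}
    (hε : 0 < ε) :
    Tendsto (fun n : ℕ => (binomialRandom (Fin n) p).real
      {G | (G.hadwigerNumber : ℝ) < (1 - ε) * (n / √(Real.log n / l))}) atTop (𝓝 0) := by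
  -- There will be at least `(1 - 3η) n / r` candidate sets, of which a proportion `η` may be lost:
  -- `(1 - η)(1 - 3η) ≥ 1 - 4η ≥ 1 - ε`.
  obtain ⟨η, hη0, hη1, hηε⟩ : ∃ η : ℝ, 0 < η ∧ η ≤ 1 / 4 ∧ 4 * η ≤ ε :=
    ⟨min (1 / 4) (ε / 4), by positivity, min_le_left _ _, by linarith [min_le_right (1 / 4) (ε / 4)]⟩
  have hp1 : (p : ℝ) < 1 := by linarith [Real.exp_pos (-l)]
  have hlog : Tendsto (fun n : ℕ => Real.log n) atTop atTop :=
    Real.tendsto_log_atTop.comp tendsto_natCast_atTop_atTop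
  have hr : Tendsto (fun n : ℕ => √(Real.log n / l)) atTop atTop :=
    Real.tendsto_sqrt_atTop.comp (hlog.atTop_div_const hl)
  let s : ℕ → ℕ := fun n => ⌈(1 + η) * √(Real.log n / l)⌉₊
  have hs : Tendsto s atTop atTop :=
    tendsto_nat_ceil_atTop.comp (hr.const_mul_atTop (by linarith))
  set a : ℝ := 1 - (p : ℝ) ^ 2 with ha
  have ha0 : 0 < a := by nlinarith
  have ha1 : a < 1 := by nlinarith
  have hconn : Tendsto (fun n => (s n : ℝ) ^ 2 * a ^ (s n - 2)) atTop (𝓝 0) := by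
    have h := ((tendsto_pow_const_mul_const_pow_of_abs_lt_one 2
      (by rwa [abs_of_pos ha0] : |a| < 1)).comp hs).mul_const (a ^ 2)⁻¹
    rw [zero_mul] at h
    refine h.congr' ?_
    filter_upwards [hs.eventually (eventually_ge_atTop 2)] with n hn
    simp only [Function.comp]
    rw [← pow_sub_mul_pow a hn]
    field_simp
  have hpow : Tendsto (fun n : ℕ => Real.exp (-(η * Real.log n))) atTop (𝓝 0) :=
    Real.tendsto_exp_neg_atTop_nhds_zero.comp (hlog.const_mul_atTop hη0)
  have hy : Tendsto (fun n : ℕ => (n : ℝ) / √(Real.log n / l)) atTop atTop := by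
    have h1 : Tendsto (fun n : ℕ => Real.exp (Real.log n / 2)) atTop atTop :=
      Real.tendsto_exp_atTop.comp (hlog.atTop_div_const two_pos)
    refine tendsto_atTop_mono' _ ?_ (h1.const_mul_atTop (Real.sqrt_pos.2 hl))
    filter_upwards [hlog.eventually (eventually_gt_atTop 0), eventually_ge_atTop 1] with n hn hn1
    have hnx : (n : ℝ) = Real.exp (Real.log n / 2) * Real.exp (Real.log n / 2) := by
      rw [← Real.exp_add, add_halves, Real.exp_log (by exact_mod_cast hn1)]
    have h2 : √(Real.log n) ≤ Real.exp (Real.log n / 2) := by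
      rw [Real.sqrt_le_left (Real.exp_pos _).le, sq, ← Real.exp_add, add_halves]
      linarith [Real.add_one_le_exp (Real.log n)]
    rw [Real.sqrt_div hn.le, le_div_iff₀ (by positivity)]
    calc √l * Real.exp (Real.log n / 2) * (√(Real.log n) / √l)
        = Real.exp (Real.log n / 2) * √(Real.log n) := by field_simp
      _ ≤ Real.exp (Real.log n / 2) * Real.exp (Real.log n / 2) := by gcongr
      _ = n := hnx.symm
  have hlim := (hconn.add hpow).div_const η
  rw [add_zero, zero_div] at hlim
  refine squeeze_zero' (Eventually.of_forall fun n => MeasureTheory.measureReal_nonneg) ?_ hlim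
  -- The two thresholds `1 / η` absorb rounding: of `s` upwards, giving `s ≤ (1 + 2η) r`, and of `t
  -- = n / s` downwards, at most `η n / r`.
  filter_upwards [hr.eventually (eventually_ge_atTop (1 / η)), hy.eventually
    (eventually_ge_atTop (1 / η)), eventually_ge_atTop 1, hlog.eventually (eventually_gt_atTop 0)]
    with n hrn hyn hn1 hlog0
  have hL0 : 0 < Real.log n / l := by positivity
  have hr2 : √(Real.log n / l) ^ 2 = Real.log n / l := Real.sq_sqrt hL0.le
  have hs1 : (1 + η) * √(Real.log n / l) ≤ s n := Nat.le_ceil _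
  have hs2 : (s n : ℝ) < (1 + η) * √(Real.log n / l) + 1 := Nat.ceil_lt_add_one (by positivity)
  generalize s n = s at hs1 hs2
  have hr0 : 0 < √(Real.log n / l) := Real.sqrt_pos.2 hL0
  set r := √(Real.log n / l) with hrdef
  set y := (n : ℝ) / r with hydef
  have hs0 : 0 < (s : ℝ) := lt_of_lt_of_le (by positivity) hs1
  have hsr : (s : ℝ) ≤ (1 + 2 * η) * r := by
    rw [div_le_iff₀ hη0] at hrn
    linarith
  obtain ⟨t, ht⟩ : ∃ t, t = n / s := ⟨_, rfl⟩
  have hts : t * s ≤ n := ht ▸ Nat.div_mul_le_self n s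
  have hty : (1 - 3 * η) * y ≤ t := by
    have h1 : (n : ℝ) < (t + 1) * s := by
      have := Nat.lt_mul_of_div_lt (lt_add_one (n / s)) (by exact_mod_cast hs0)
      rw [← ht] at this
      exact_mod_cast this
    have hy0 : 0 < y := lt_of_lt_of_le (by positivity) hyn
    have h2 : y * r = n := div_mul_cancel₀ _ hr0.ne'
    have h3 : y < (t + 1) * (1 + 2 * η) := by
      refine lt_of_mul_lt_mul_right (a := r) ?_ hr0.le
      rw [h2, mul_assoc]
      exact h1.trans_le (by gcongr)
    rw [div_le_iff₀ hη0] at hyn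
    have h4 : (1 - 2 * η) * y ≤ t + 1 := by
      have h5 : (1 - 2 * η) * y ≤ (1 - 2 * η) * ((t + 1) * (1 + 2 * η)) :=
        mul_le_mul_of_nonneg_left h3.le (by linarith)
      nlinarith [mul_nonneg (sq_nonneg η) (by positivity : (0 : ℝ) ≤ t + 1)]
    linarith
  have hy0 : 0 < y := lt_of_lt_of_le (by positivity) hyn
  have ht0 : 0 < (t : ℝ) := lt_of_lt_of_le (mul_pos (by linarith) hy0) hty
  obtain ⟨S, hS, hcard⟩ := Fin.exists_pairwise_disjoint_card_eq hts
  have hmain := mul_binomialRandom_real_hadwigerNumber_le p (by exact_mod_cast hs0) S hS hcard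
    (η * t)
  -- Here `s² ≥ (1 + η) log_b n` makes a pair fail with probability at most `n ^ (-1 - η)`, while `t
  -- ≤ n`.
  have hq : t * (1 - (p : ℝ)) ^ (s ^ 2) ≤ Real.exp (-(η * Real.log n)) := by
    have htn : (t : ℝ) ≤ Real.exp (Real.log n) := by
      rw [Real.exp_log (by exact_mod_cast hn1), ht]
      exact_mod_cast Nat.div_le_self n s
    have hs3 : (1 + η) * (Real.log n / l) ≤ (s : ℝ) ^ 2 := by
      calc (1 + η) * (Real.log n / l) ≤ (1 + η) ^ 2 * (Real.log n / l) := by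
            gcongr
            nlinarith
        _ = ((1 + η) * r) ^ 2 := by rw [mul_pow, hr2]
        _ ≤ _ := by gcongr
    rw [hpl, ← Real.exp_nat_mul]
    calc (t : ℝ) * Real.exp (((s ^ 2 : ℕ) : ℝ) * -l)
        ≤ Real.exp (Real.log n) * Real.exp (-((1 + η) * Real.log n)) := by
          gcongr
          push_cast
          have h6 := mul_le_mul_of_nonneg_right hs3 hl.le
          rw [mul_assoc, div_mul_cancel₀ _ hl.ne'] at h6
          linarith
      _ = _ := by
          rw [← Real.exp_add]
          ring_nf
  rw [le_div_iff₀ hη0]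
  refine le_of_mul_le_mul_left ?_ ht0
  calc t * ((binomialRandom (Fin n) p).real {G | (G.hadwigerNumber : ℝ) < (1 - ε) * y} * η)
      ≤ t * ((binomialRandom (Fin n) p).real {G | (G.hadwigerNumber : ℝ) ≤ t - η * t} * η) := by
        gcongr t * (?_ * η)
        refine MeasureTheory.measureReal_mono ?_
        intro G hG
        rw [Set.mem_ofPred_eq] at hG ⊢
        refine le_of_lt (lt_of_lt_of_le hG ?_)
        have h1 : (1 - η) * ((1 - 3 * η) * y) ≤ (1 - η) * t :=
          mul_le_mul_of_nonneg_left hty (by linarith)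
        nlinarith [mul_nonneg (sq_nonneg η) hy0.le, mul_le_mul_of_nonneg_right hηε hy0.le]
    _ = η * t * (binomialRandom (Fin n) p).real {G | (G.hadwigerNumber : ℝ) ≤ t - η * t} := by ring
    _ ≤ _ := hmain
    _ = t * (s ^ 2 * a ^ (s - 2) + t * (1 - (p : ℝ)) ^ (s ^ 2)) := by ring
    _ ≤ _ := by gcongr

/-! ### Combining the two bounds. -/

/-- With probability tending to `1`, both the Hadwiger number and the fractional Hadwiger number
of `G(n,p)` are within a factor `1 ± ε` of `n / √(log_b n)`. -/
theorem SimpleGraph.tendsto_binomialRandom_hadwigerNumber_ge_fractionalHadwigerNumber_le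
    (p : unitInterval) (hp0 : 0 < p) (hp1 : p < 1) {ε : ℝ} (hε : 0 < ε) :
    Filter.Tendsto (fun n : ℕ => binomialRandom (Fin n) p {G |
      (1 - ε) * (n / √(Real.logb (1 / (1 - (p : ℝ))) n)) ≤ G.hadwigerNumber ∧
      G.fractionalHadwigerNumber ≤ (1 + ε) * (n / √(Real.logb (1 / (1 - (p : ℝ))) n))})
      Filter.atTop (nhds 1) := by
  have hp0' : (0 : ℝ) < p := hp0
  have hp1' : 0 < 1 - (p : ℝ) := sub_pos.2 hp1
  -- `l = log b`, so `Real.log n / l` is `log_b n` by definition.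
  set l := Real.log (1 / (1 - (p : ℝ))) with hl
  have hl0 : 0 < l := Real.log_pos (by rw [lt_div_iff₀ hp1']; linarith)
  have hpl : 1 - (p : ℝ) = Real.exp (-l) := by
    rw [hl, one_div, Real.log_inv, neg_neg, Real.exp_log hp1']
  have h := (tendsto_binomialRandom_real_hadwigerNumber_lt p hp0' hl0 hpl hε).add
    (tendsto_binomialRandom_real_lt_fractionalHadwigerNumber p hl0 hpl hε)
  have h1 := ENNReal.tendsto_ofReal (h.const_sub 1)
  rw [add_zero, sub_zero, ENNReal.ofReal_one] at h1
  refine tendsto_of_tendsto_of_tendsto_of_le_of_le h1 tendsto_const_nhds (fun n => ?_)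
    fun n => MeasureTheory.prob_le_one
  refine ENNReal.ofReal_le_of_le_toReal ?_
  rw [← MeasureTheory.measureReal_def, sub_le_comm,
    ← MeasureTheory.probReal_compl_eq_one_sub .of_discrete]
  refine le_trans (MeasureTheory.measureReal_mono fun G hG => ?_)
    (MeasureTheory.measureReal_union_le _ _)
  rw [Set.mem_compl_iff, Set.mem_ofPred_eq, not_and_or, not_le, not_le] at hG
  exact hG

/-- For fixed `0 < p < 1`, with `b = 1 / (1 - p)`: with probability tending to `1` as `n → ∞`,
`h_f(G(n,p)) = (1 + o(1)) n / √(log_b n)`, and `h_f(G(n,p)) = (1 + o(1)) h(G(n,p))`. -/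
theorem theorem2 (p : unitInterval) (hp0 : 0 < p) (hp1 : p < 1) :
    (∀ ε : ℝ, 0 < ε →
      Filter.Tendsto
        (fun n : ℕ => SimpleGraph.binomialRandom (Fin n) p
          {G : SimpleGraph (Fin n) |
            |G.fractionalHadwigerNumber - n / √(Real.logb (1 / (1 - (p : ℝ))) n)|
              ≤ ε * (n / √(Real.logb (1 / (1 - (p : ℝ))) n))})
        Filter.atTop (nhds 1)) ∧
    (∀ ε : ℝ, 0 < ε →
      Filter.Tendsto
        (fun n : ℕ => SimpleGraph.binomialRandom (Fin n) p
          {G : SimpleGraph (Fin n) |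
            |G.fractionalHadwigerNumber - (G.hadwigerNumber : ℝ)|
              ≤ ε * (G.hadwigerNumber : ℝ)})
        Filter.atTop (nhds 1)) := by
  have hy : ∀ n : ℕ, 0 ≤ (n : ℝ) / √(Real.logb (1 / (1 - (p : ℝ))) n) := fun n => by positivity
  constructor
  · intro ε hε
    refine tendsto_of_tendsto_of_tendsto_of_le_of_le
      (SimpleGraph.tendsto_binomialRandom_hadwigerNumber_ge_fractionalHadwigerNumber_le p hp0 hp1 hε)
      tendsto_const_nhds (fun n => MeasureTheory.measure_mono ?_)
      fun n => MeasureTheory.prob_le_one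
    rintro G ⟨h1, h2⟩
    have h3 := G.hadwigerNumber_le_fractionalHadwigerNumber
    rw [Set.mem_ofPred_eq, abs_le]
    constructor <;> linarith
  · intro ε hε
    -- The gap `h_f - h` is at most `2δy`. As `δ ≤ 1 / 2`, this is at most `4δ(1 - δ)y ≤ ε h`.
    obtain ⟨δ, hδ0, hδ1, hδε⟩ : ∃ δ : ℝ, 0 < δ ∧ δ ≤ 1 / 2 ∧ 4 * δ ≤ ε :=
      ⟨min (1 / 2) (ε / 4), by positivity, min_le_left _ _,
        by linarith [min_le_right (1 / 2) (ε / 4)]⟩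
    refine tendsto_of_tendsto_of_tendsto_of_le_of_le
      (SimpleGraph.tendsto_binomialRandom_hadwigerNumber_ge_fractionalHadwigerNumber_le p hp0 hp1 hδ0)
      tendsto_const_nhds (fun n => MeasureTheory.measure_mono ?_)
      fun n => MeasureTheory.prob_le_one
    rintro G ⟨h1, h2⟩
    have h3 := G.hadwigerNumber_le_fractionalHadwigerNumber
    rw [Set.mem_ofPred_eq, abs_of_nonneg (sub_nonneg.2 h3)]
    have hyn := hy n
    set y := (n : ℝ) / √(Real.logb (1 / (1 - (p : ℝ))) n)
    calc G.fractionalHadwigerNumber - G.hadwigerNumber ≤ 2 * δ * y := by linarith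
      _ ≤ 4 * δ * ((1 - δ) * y) := by
        nlinarith [mul_nonneg (mul_nonneg hδ0.le hyn) (sub_nonneg.2 hδ1)]
      _ ≤ ε * ((1 - δ) * y) := by
        gcongr
        exact mul_nonneg (by linarith) hyn
      _ ≤ ε * G.hadwigerNumber := by gcongr
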